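/- Let $(W,S)$ be an arbitrary Coxeter system ($W$ and $S$ possibly infinite), with length function $\ell$ and set of reflections $T=\bigcup_{w\in W}wSw^{-1}$, and put $N(w)=\{t\in T:\ell(tw)<\ell(w)\}$ for $w\in W$. Let $B$ be the Artin group of $(W,S)$, with standard generators $\sigma_s$ $(s\in S)$, and let $\pi:B\to W$ be the projection $\sigma_s\mapsto s$. For $w\in W$ with reduced expression $w=s_1\cdots s_k$ in $S$, the positive lift of $w$ is $\underline{w}=\sigma_{s_1}\cdots\sigma_{s_k}\in B$; it does not depend on the choice of the reduced expression. Let $W_0\le W$ be a reflection subgroup, that is, a subgroup generated by a (possibly infinite) subset of $T$, and let $S_0=\{t\in T: N(t)\cap W_0=\{t\}\}$. Let $K_0\le B$ be the subgroup generated by the elements $\beta\sigma_s^2\beta^{-1}$ with $\beta\in B$, $s\in S$ and $\pi(\beta\sigma_s\beta^{-1})\notin W_0$; it is a normal subgroup of $\pi^{-1}(W_0)$. Define $\psi:W_0\to\pi^{-1}(W_0)/K_0$ by $\psi(w)=\underline{w}K_0$. Then $\psi$ is injective, $(W_0,S_0)$ is a Coxeter system, and the following hold. 1. If $w_1,w_2\in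 W_0$ satisfy $\ell_0(w_1w_2)=\ell_0(w_1)+\ell_0(w_2)$, where $\ell_0$ is the length function of $W_0$ relative to $S_0$, then $\psi(w_1w_2)=\psi(w_1)\psi(w_2)$. 2. If $w\in W_0$ has a reduced expression $w=t_1t_2\cdots t_k$ in terms of $S_0$, then $\psi(w)=\psi(t_1)\psi(t_2)\cdots\psi(t_k)$. 3. Let $B_0$ be the Artin group of the Coxeter system $(W_0,S_0)$. There is a unique group homomorphism $\widetilde\psi:B_0\to\pi^{-1}(W_0)/K_0$ such that $\widetilde\psi(\beta)=\psi(w)$ for every $w\in W_0$ and every positive lift $\beta\in B_0$ of $w$ (the product of the Artin generators along a reduced expression of $w$ in $S_0$). -/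

import Mathlib

namespace ArtinLift

section ArtinGroup

variable {ι : Type*}

/-- The braid relation `⋯ σ_i' σ_i σ_i' = ⋯ σ_i σ_i' σ_i` (alternating products with `M i i'`
factors on both sides) written as an element of the free group. It is trivial if `M i i' = 0`, which
encodes `m(i, i') = ∞`. -/
def braidRelation (M : CoxeterMatrix ι) (i i' : ι) : FreeGroup ι :=
  ((CoxeterSystem.alternatingWord i i' (M i i')).map FreeGroup.of).prod *
    ((CoxeterSystem.alternatingWord i' i (M i i')).map FreeGroup.of).prod⁻¹

/-- The Artin group of a Coxeter matrix: generators `σ_i`, subject to the braid relations. -/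
abbrev ArtinGroup (M : CoxeterMatrix ι) : Type _ :=
  PresentedGroup (Set.range (Function.uncurry (braidRelation M)))

/-- The standard generator `σ_i` of the Artin group. -/
def artinGen (M : CoxeterMatrix ι) (i : ι) : ArtinGroup M :=
  PresentedGroup.of i

/-- The product `σ_{i_1} ⋯ σ_{i_k}` in the Artin group of a word `[i_1, …, i_k]`. -/
def artinWord (M : CoxeterMatrix ι) (ω : List ι) : ArtinGroup M :=
  (ω.map (artinGen M)).prod

variable {W : Type*} [Group W] {M : CoxeterMatrix ι} (cs : CoxeterSystem M W)

/-- The projection `π` from the Artin group to the Coxeter group, `σ_i ↦ s_i`. -/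
def artinProj : ArtinGroup M →* W :=
  PresentedGroup.toGroup (f := cs.simple) (by
    rintro _ ⟨⟨i, i'⟩, rfl⟩
    have h := cs.wordProd_braidWord_eq i i'
    simp only [CoxeterSystem.braidWord, CoxeterSystem.wordProd, M.symmetric i' i] at h
    simp [braidRelation, Function.uncurry, map_list_prod, List.map_map, Function.comp_def, h])

@[simp] theorem artinProj_artinGen (i : ι) : artinProj cs (artinGen M i) = cs.simple i :=
  PresentedGroup.toGroup.of _

theorem artinProj_artinWord (ω : List ι) : artinProj cs (artinWord M ω) = cs.wordProd ω := by
  simp [artinWord, CoxeterSystem.wordProd, map_list_prod, List.map_map, Function.comp_def]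

/-- `β` is a positive lift of `w`: it is `σ_{i_1} ⋯ σ_{i_k}` for some reduced expression
`w = s_{i_1} ⋯ s_{i_k}`. -/
def IsPositiveLift (w : W) (β : ArtinGroup M) : Prop :=
  ∃ ω : List ι, cs.IsReduced ω ∧ cs.wordProd ω = w ∧ artinWord M ω = β

theorem exists_isPositiveLift (w : W) : ∃ β, IsPositiveLift cs w β := by
  obtain ⟨ω, hω, rfl⟩ := cs.exists_isReduced w
  exact ⟨_, ω, hω, rfl, rfl⟩

/-- The positive lift of `w`, formed from some reduced expression of `w`. -/
noncomputable def posLift (w : W) : ArtinGroup M :=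
  (exists_isPositiveLift cs w).choose

theorem artinProj_posLift (w : W) : artinProj cs (posLift cs w) = w := by
  obtain ⟨ω, _, hw, hβ⟩ := (exists_isPositiveLift cs w).choose_spec
  rw [posLift, ← hβ, artinProj_artinWord, hw]

end ArtinGroup

section ReflectionSubgroup

variable {ι W : Type*} [Group W] {M : CoxeterMatrix ι} (cs : CoxeterSystem M W) (W₀ : Subgroup W)

/-- A reflection subgroup is a subgroup generated by a set of reflections. -/
def IsReflectionSubgroup : Prop :=
  ∃ A : Set W, (∀ t ∈ A, cs.IsReflection t) ∧ Subgroup.closure A = W₀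

/-- The left inversion set `N(w) = {t ∈ T : ℓ(t w) < ℓ(w)}`. -/
def inversionSet (w : W) : Set W := {t | cs.IsLeftInversion w t}

/-- The canonical generating set `S₀ = {t ∈ T : N(t) ∩ W₀ = {t}}`. -/
def canonicalGens : Set W :=
  {t | cs.IsReflection t ∧ inversionSet cs t ∩ (W₀ : Set W) = {t}}

/-- The Coxeter matrix of `(W₀, S₀)`: `m(s, t)` is the order of `s t`, with value `0` if that order
is infinite. -/
noncomputable def canonicalMatrix : CoxeterMatrix (canonicalGens cs W₀) where
  M := Matrix.of fun s t => orderOf ((s : W) * (t : W))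
  isSymm := by
    ext s t
    have h : ((s : W) * (t : W))⁻¹ = (t : W) * (s : W) := by
      rw [mul_inv_rev, s.2.1.inv, t.2.1.inv]
    simp only [Matrix.transpose_apply, Matrix.of_apply]
    rw [← h, orderOf_inv]
  diagonal := fun s => by
    simp only [Matrix.of_apply, orderOf_eq_one_iff]
    exact s.2.1.mul_self
  off_diagonal := fun s t hst h => hst <| by
    simp only [Matrix.of_apply, orderOf_eq_one_iff] at h
    have h' := mul_eq_one_iff_eq_inv.mp h
    rw [t.2.1.inv] at h'
    exact Subtype.ext h'

/-- `K₀`: the subgroup of the Artin group generated by the `β σ² β⁻¹` for which the reflection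
`π(β σ β⁻¹)` does not belong to `W₀`. -/
def K₀ : Subgroup (ArtinGroup M) :=
  Subgroup.closure {x | ∃ (β : ArtinGroup M) (i : ι),
    artinProj cs (β * artinGen M i * β⁻¹) ∉ W₀ ∧ x = β * artinGen M i ^ 2 * β⁻¹}

/-- `π⁻¹(W₀)`. -/
abbrev preimage : Subgroup (ArtinGroup M) := W₀.comap (artinProj cs)

theorem K₀_le_ker : K₀ cs W₀ ≤ (artinProj cs).ker := by
  rw [K₀, Subgroup.closure_le]
  rintro _ ⟨β, i, -, rfl⟩
  simp [MonoidHom.mem_ker, pow_two]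

theorem K₀_le_preimage : K₀ cs W₀ ≤ preimage cs W₀ := fun x hx => by
  rw [Subgroup.mem_comap, MonoidHom.mem_ker.mp (K₀_le_ker cs W₀ hx)]
  exact W₀.one_mem

theorem conj_mem_K₀ {g x : ArtinGroup M} (hg : g ∈ preimage cs W₀) (hx : x ∈ K₀ cs W₀) :
    g * x * g⁻¹ ∈ K₀ cs W₀ := by
  induction hx using Subgroup.closure_induction with
  | mem x hx =>
    obtain ⟨β, i, hβ, rfl⟩ := hx
    refine Subgroup.subset_closure ⟨g * β, i, fun h => hβ ?_, by group⟩
    have h1 : artinProj cs (β * artinGen M i * β⁻¹) =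
        (artinProj cs g)⁻¹ * artinProj cs (g * β * artinGen M i * (g * β)⁻¹) * artinProj cs g := by
      rw [← map_inv, ← map_mul, ← map_mul]
      congr 1
      group
    rw [h1]
    exact W₀.mul_mem (W₀.mul_mem (W₀.inv_mem hg) h) hg
  | one => simp
  | mul x y _ _ hx hy =>
    have h : g * (x * y) * g⁻¹ = (g * x * g⁻¹) * (g * y * g⁻¹) := by group
    rw [h]
    exact mul_mem hx hy
  | inv x _ hx =>
    have h : g * x⁻¹ * g⁻¹ = (g * x * g⁻¹)⁻¹ := by group
    rw [h]
    exact inv_mem hx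

instance K₀_normal : ((K₀ cs W₀).subgroupOf (preimage cs W₀)).Normal where
  conj_mem _ hx g := conj_mem_K₀ cs W₀ g.2 hx

/-- The group `π⁻¹(W₀) / K₀`. -/
abbrev LiftQuotient : Type _ := preimage cs W₀ ⧸ (K₀ cs W₀).subgroupOf (preimage cs W₀)

/-- The map `ψ : W₀ → π⁻¹(W₀) / K₀` sending `w` to the class of its positive lift. -/
noncomputable def psi (w : W₀) : LiftQuotient cs W₀ :=
  QuotientGroup.mk (⟨posLift cs (w : W), by
    rw [Subgroup.mem_comap, artinProj_posLift]
    exact w.2⟩ : preimage cs W₀)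

end ReflectionSubgroup

end ArtinLift

/-! Everything rests on the cocycle identity `N(xy) = N(x) ∆ x N(y) x⁻¹`. It is proved by letting
`W` act on `W × ZMod 2` so that the sign records the parity of occurrences in inversion sequences
(`isReflectionCocycle_inversionSet`). The identity survives intersection with `W₀`, where `S₀`
consists of the reflections with `N(t) ∩ W₀ = {t}`; these generate `W₀` by induction on length
(`reflection_mem_closure_canonicalGens`).

Involutive generators with `N(s) = {s}` and such a cocycle already give `|N(w)| = ℓ(w)`, the
exchange property, Matsumoto's theorem and hence a Coxeter presentation. This abstract theory
(`IsReflectionCocycle`) is used for both `(W, S)` and `(W₀, S₀)`. The geometric representation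
enters only to show that `s_i s_j` has order exactly `M i j`.

For `ψ`, append `σ_s` to the positive lift of `x`. If the length grows, the result is the lift of
`xs`; if it drops, the discrepancy is a conjugate of `σ_s²`, which lies in `K₀` when `x s x⁻¹ ∉ W₀`.
So lifts multiply modulo `K₀` when `N(x⁻¹)` and `N(y)` share no element of `W₀` (`posLift_mul_mem`),
which follows from additivity of `ℓ₀` by counting. The braid relations for `ψ(t)`, `t ∈ S₀`, follow
because both sides are reduced expressions of one element. -/

namespace ArtinLift

/-! ### Alternating words and braid relations -/

/-- The word of length `n` alternating between `i` and `j` and starting with `i`. -/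
def altWord {ι : Type*} (i j : ι) : ℕ → List ι
  | 0 => []
  | n + 1 => i :: altWord j i n

theorem length_altWord {ι : Type*} (i j : ι) (n : ℕ) : (altWord i j n).length = n := by
  induction n generalizing i j with
  | zero => rfl
  | succ n ih => simp [altWord, ih]

/-- `alternatingWord` fixes the last letter and `altWord` the first, so the parity of the length
decides which is which. -/
theorem alternatingWord_eq_altWord {ι : Type*} (i j : ι) (n : ℕ) :
    CoxeterSystem.alternatingWord i j n = if Even n then altWord i j n else altWord j i n := by
  induction n with
  | zero => simp [altWord, CoxeterSystem.alternatingWord]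
  | succ n ih =>
    rw [CoxeterSystem.alternatingWord_succ', ih]
    by_cases h : Even n <;> simp [h, Nat.even_add_one, altWord]

theorem alternatingWord_prod_eq_iff {ι G : Type*} [Monoid G] (f : ι → G) (i j : ι) (n : ℕ) :
    ((CoxeterSystem.alternatingWord i j n).map f).prod =
        ((CoxeterSystem.alternatingWord j i n).map f).prod ↔
      ((altWord i j n).map f).prod = ((altWord j i n).map f).prod := by
  simp only [alternatingWord_eq_altWord]
  by_cases h : Even n <;> simp [h, eq_comm]

theorem altWord_prod_mul_inv {ι G : Type*} [Group G] (f : ι → G) (hf : ∀ i, f i * f i = 1)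
    (i j : ι) (n : ℕ) :
    ((altWord i j n).map f).prod * ((altWord j i n).map f).prod⁻¹ = (f i * f j) ^ n := by
  induction n generalizing i j with
  | zero => simp [altWord]
  | succ n ih =>
    have hj : (f j)⁻¹ = f j := inv_eq_of_mul_eq_one_right (hf j)
    simp only [altWord, List.map_cons, List.prod_cons, mul_inv_rev]
    calc _ = f i * (((altWord j i n).map f).prod * ((altWord i j n).map f).prod⁻¹) * (f j)⁻¹ := by
          group
      _ = f i * (f j * f i) ^ n * f j := by rw [ih, hj]
      _ = _ := by rw [← mul_pow_mul, mul_assoc, pow_succ]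

theorem altWord_prod_eq_iff {ι G : Type*} [Group G] (f : ι → G) (hf : ∀ i, f i * f i = 1)
    (i j : ι) (n : ℕ) :
    ((altWord i j n).map f).prod = ((altWord j i n).map f).prod ↔ (f i * f j) ^ n = 1 := by
  rw [← altWord_prod_mul_inv f hf, mul_inv_eq_one]

/-! ### Reflection cocycles: exchange and Matsumoto's theorem -/

/-- `N` is a reflection cocycle on the group `W` generated by the involutions `s i`, and `ℓ` is
the word length with respect to these generators. -/
structure IsReflectionCocycle {ι W : Type*} [Group W] (s : ι → W) (N : W → Set W) (ℓ : W → ℕ) :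
    Prop where
  simple_mul_self : ∀ i, s i * s i = 1
  simple : ∀ i, N (s i) = {s i}
  mem_mul : ∀ x y t, t ∈ N (x * y) ↔ Xor (t ∈ N x) (x⁻¹ * t * x ∈ N y)
  length_le : ∀ ω : List ι, ℓ (ω.map s).prod ≤ ω.length
  exists_word : ∀ w, ∃ ω : List ι, (ω.map s).prod = w ∧ ω.length = ℓ w

namespace IsReflectionCocycle

variable {ι W : Type*} [Group W] {s : ι → W} {N : W → Set W} {ℓ : W → ℕ}
  (h : IsReflectionCocycle s N ℓ)
include h

theorem inv_simple (i : ι) : (s i)⁻¹ = s i := inv_eq_of_mul_eq_one_right (h.simple_mul_self i)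

theorem simple_mul_cancel (i : ι) (w : W) : s i * (s i * w) = w := by
  rw [← mul_assoc, h.simple_mul_self, one_mul]

theorem notMem_one (t : W) : t ∉ N 1 := by
  have := h.mem_mul 1 1 t
  simp [Xor] at this
  exact this

theorem mem_simple_mul (i : ι) (w t : W) :
    t ∈ N (s i * w) ↔ Xor (t = s i) (s i * t * s i ∈ N w) := by
  rw [h.mem_mul, h.simple, h.inv_simple, Set.mem_singleton_iff]

theorem simple_mem_simple_mul (i : ι) (w : W) : s i ∈ N (s i * w) ↔ s i ∉ N w := by
  rw [h.mem_simple_mul, h.simple_mul_self, one_mul]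
  simp [Xor]

theorem mem_inv (w t : W) : t ∈ N w⁻¹ ↔ w * t * w⁻¹ ∈ N w := by
  have := h.mem_mul w⁻¹ w t
  simp only [inv_mul_cancel, h.notMem_one, Xor, inv_inv] at this
  grind

theorem length_one : ℓ 1 = 0 := by simpa using h.length_le []

theorem eq_one_of_length (w : W) (hw : ℓ w = 0) : w = 1 := by
  obtain ⟨ω, rfl, hω⟩ := h.exists_word w
  rw [hw, List.length_eq_zero_iff] at hω
  simp [hω]

theorem length_mul_le (x y : W) : ℓ (x * y) ≤ ℓ x + ℓ y := by
  obtain ⟨ω, rfl, hω⟩ := h.exists_word x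
  obtain ⟨ω', rfl, hω'⟩ := h.exists_word y
  simpa [hω, hω'] using h.length_le (ω ++ ω')

theorem length_simple_le (i : ι) : ℓ (s i) ≤ 1 := by simpa using h.length_le [i]

theorem length_simple_mul_le (i : ι) (w : W) : ℓ (s i * w) ≤ ℓ w + 1 := by
  have := h.length_mul_le (s i) w
  have := h.length_simple_le i
  omega

theorem exists_simple_mul (w : W) (hw : w ≠ 1) : ∃ i v, w = s i * v ∧ ℓ w = ℓ v + 1 := by
  obtain ⟨ω, rfl, hω⟩ := h.exists_word w
  match ω with
  | [] => simp at hw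
  | i :: α =>
    refine ⟨i, (α.map s).prod, by simp, ?_⟩
    have h1 := h.length_le α
    have h2 := h.length_simple_mul_le i (α.map s).prod
    simp only [List.map_cons, List.prod_cons, List.length_cons] at *
    omega

theorem length_mul_lt {w t : W} (ht : t ∈ N w) : ℓ (t * w) < ℓ w := by
  induction hn : ℓ w generalizing w t with
  | zero =>
    rw [h.eq_one_of_length w hn] at ht
    exact absurd ht (h.notMem_one t)
  | succ n ih =>
    have hw : w ≠ 1 := fun hw => h.notMem_one t (hw ▸ ht)
    obtain ⟨i, v, rfl, hl⟩ := h.exists_simple_mul w hw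
    rcases Xor.or ((h.mem_simple_mul i v t).mp ht) with rfl | ht'
    · rw [h.simple_mul_cancel]
      omega
    · have := ih ht' (by omega)
      have h2 := h.length_simple_mul_le i (s i * t * s i * v)
      rw [show s i * (s i * t * s i * v) = t * (s i * v) by
        simp only [mul_assoc, h.simple_mul_cancel]] at h2
      omega

theorem length_simple_mul_of_mem {i : ι} {w : W} (hi : s i ∈ N w) : ℓ w = ℓ (s i * w) + 1 := by
  have h1 := h.length_mul_lt hi
  have h2 := h.length_simple_mul_le i (s i * w)
  rw [h.simple_mul_cancel] at h2
  omega

theorem length_simple_mul_of_notMem {i : ι} {w : W} (hi : s i ∉ N w) :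
    ℓ (s i * w) = ℓ w + 1 := by
  have := h.length_simple_mul_of_mem ((h.simple_mem_simple_mul i w).mpr hi)
  rwa [h.simple_mul_cancel] at this

theorem simple_mem_iff (i : ι) (w : W) : s i ∈ N w ↔ ℓ (s i * w) < ℓ w := by
  refine ⟨fun hi => h.length_mul_lt hi, fun hl => ?_⟩
  by_contra hi
  have := h.length_simple_mul_of_notMem hi
  omega

theorem exists_descent (w : W) (hw : w ≠ 1) :
    ∃ i v, w = s i * v ∧ s i ∉ N v ∧ ℓ w = ℓ v + 1 := by
  obtain ⟨i, v, rfl, hl⟩ := h.exists_simple_mul w hw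
  refine ⟨i, v, rfl, fun hi => ?_, hl⟩
  have := h.length_simple_mul_of_mem hi
  omega

/-- Left induction along reduced expressions. -/
theorem reduced_induction {p : W → Prop} (w : W) (one : p 1)
    (mul : ∀ i v, s i ∉ N v → p v → p (s i * v)) : p w := by
  induction hn : ℓ w generalizing w with
  | zero => rwa [h.eq_one_of_length w hn]
  | succ n ih =>
    have hw : w ≠ 1 := fun hw => by simp [hw, h.length_one] at hn
    obtain ⟨i, v, rfl, hi, hl⟩ := h.exists_descent w hw
    exact mul i v hi (ih v (by omega))

theorem reflectionSet_simple_mul {i : ι} {w : W} (hi : s i ∉ N w) :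
    N (s i * w) = insert (s i) ((MulAut.conj (s i)) '' N w) := by
  ext t
  rw [h.mem_simple_mul, Set.mem_insert_iff]
  have h1 : t ∈ (MulAut.conj (s i)) '' N w ↔ s i * t * s i ∈ N w := by
    constructor
    · rintro ⟨u, hu, rfl⟩
      simpa [h.inv_simple, mul_assoc, h.simple_mul_cancel, h.simple_mul_self] using hu
    · exact fun ht => ⟨_, ht, by
        simp [h.inv_simple, mul_assoc, h.simple_mul_cancel, h.simple_mul_self]⟩
  rw [h1]
  have : t = s i → s i * t * s i ∉ N w := by
    rintro rfl
    simpa [h.simple_mul_self] using hi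
  grind [Xor]

/-- Along a reduced expression, each new first letter `s` conjugates the old inversions and adds
just `s`. -/
theorem finite_and_ncard (w : W) : (N w).Finite ∧ (N w).ncard = ℓ w := by
  induction w using h.reduced_induction with
  | one =>
    have : N 1 = ∅ := Set.eq_empty_of_forall_notMem h.notMem_one
    simp [this, h.length_one]
  | mul i v hi ih =>
    rw [h.reflectionSet_simple_mul hi, h.length_simple_mul_of_notMem hi]
    have hf := ih.1.image (MulAut.conj (s i))
    refine ⟨hf.insert _, ?_⟩
    rw [Set.ncard_insert_of_notMem _ hf, Set.ncard_image_of_injective _ (MulEquiv.injective _),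
      ih.2]
    rintro ⟨u, hu, hu'⟩
    have : u = s i := by
      have h2 : s i * u * (s i)⁻¹ = s i := hu'
      rw [h.inv_simple] at h2
      calc u = s i * (s i * u * s i) * s i := by
            simp only [mul_assoc, h.simple_mul_self, mul_one, h.simple_mul_cancel]
        _ = s i := by rw [h2, h.simple_mul_self, one_mul]
    exact hi (this ▸ hu)

theorem finite (w : W) : (N w).Finite := (h.finite_and_ncard w).1

theorem ncard (w : W) : (N w).ncard = ℓ w := (h.finite_and_ncard w).2

/-- A cancellation in the symmetric difference would leave `N (x * y)` with fewer than `ℓ x + ℓ y`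
elements. -/
theorem notMem_of_length_mul {x y t : W} (hl : ℓ (x * y) = ℓ x + ℓ y) (ht : t ∈ N x)
    (ht' : x⁻¹ * t * x ∈ N y) : False := by
  have hsub : N (x * y) ⊆ (N x \ {t}) ∪ ((MulAut.conj x) '' N y) \ {t} := by
    intro u hu
    have hut : u ≠ t := by
      rintro rfl
      rw [h.mem_mul] at hu
      simp [Xor, ht, ht'] at hu
    rcases Xor.or ((h.mem_mul x y u).mp hu) with hu | hu
    · exact Or.inl ⟨hu, hut⟩
    · exact Or.inr ⟨⟨_, hu, by simp [mul_assoc]⟩, hut⟩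
  have hfx := h.finite x
  have hfy := (h.finite y).image (MulAut.conj x)
  have h1 := Set.ncard_le_ncard hsub (hfx.sdiff.union hfy.sdiff)
  have h2 := Set.ncard_union_le (N x \ {t}) (((MulAut.conj x) '' N y) \ {t})
  have h3 := Set.ncard_sdiff_singleton_lt_of_mem ht hfx
  have h4 : (((MulAut.conj x) '' N y) \ {t}).ncard ≤ ((MulAut.conj x) '' N y).ncard :=
    Set.ncard_le_ncard Set.sdiff_subset hfy
  rw [Set.ncard_image_of_injective _ (MulEquiv.injective _)] at h4
  rw [h.ncard] at h1 h3 h4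
  omega

theorem exists_of_mem_altWord {i j : ι} {n : ℕ} {t : W} (ht : t ∈ N ((altWord i j n).map s).prod) :
    ∃ l < n, t = (s i * s j) ^ l * s i := by
  induction n generalizing i j t with
  | zero => exact absurd ht (h.notMem_one t)
  | succ n ih =>
    simp only [altWord, List.map_cons, List.prod_cons] at ht
    rcases Xor.or ((h.mem_simple_mul i _ t).mp ht) with rfl | ht
    · exact ⟨0, by omega, by simp⟩
    · obtain ⟨l, hl, e⟩ := ih ht
      refine ⟨l + 1, by omega, ?_⟩
      calc t = s i * (s i * t * s i) * s i := by
            simp only [mul_assoc, h.simple_mul_self, mul_one, h.simple_mul_cancel]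
        _ = _ := by rw [e, ← mul_assoc, ← mul_pow_mul, pow_succ]; simp only [mul_assoc]

/-- Such an inversion has the form `s j = (s i * s j) ^ l * s i` with `l < n`, so `(s i * s j) ^ (l
+ 1) = 1`. -/
theorem orderOf_le_of_mem_altWord {i j : ι} {n : ℕ} (hj : s j ∈ N ((altWord i j n).map s).prod) :
    0 < orderOf (s i * s j) ∧ orderOf (s i * s j) ≤ n := by
  obtain ⟨l, hl, e⟩ := h.exists_of_mem_altWord hj
  have e1 : (s i * s j) ^ (l + 1) = 1 := by
    rw [pow_succ, ← mul_assoc, ← e, h.simple_mul_self]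
  have hd := orderOf_dvd_of_pow_eq_one e1
  exact ⟨Nat.pos_of_dvd_of_pos hd (by omega), (Nat.le_of_dvd (by omega) hd).trans hl⟩

omit h in
theorem orderOf_mul_swap (hs : ∀ i, (s i)⁻¹ = s i) (i j : ι) :
    orderOf (s i * s j) = orderOf (s j * s i) := by
  rw [← orderOf_inv, mul_inv_rev, hs, hs]

theorem length_altWord_prod {i j : ι} {n : ℕ}
    (hn : orderOf (s i * s j) = 0 ∨ n ≤ orderOf (s i * s j)) :
    ℓ ((altWord i j n).map s).prod = n := by
  induction n generalizing i j with
  | zero => exact h.length_one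
  | succ n ih =>
    have ho := orderOf_mul_swap h.inv_simple i j
    simp only [altWord, List.map_cons, List.prod_cons]
    rw [h.length_simple_mul_of_notMem, ih (by omega)]
    intro hi
    have := h.orderOf_le_of_mem_altWord hi
    omega

/-- Let `u` be a prefix of length `k` starting with `i`. As `s j` is no inversion of `u`, it comes
from the remaining factor; exchange deletes a letter there and puts `s j` in front of `u`. -/
theorem exists_altWord_prefix {w : W} {i j : ι} (hi : s i ∈ N w) (hj : s j ∈ N w) (k : ℕ)
    (hk : orderOf (s i * s j) = 0 ∨ k ≤ orderOf (s i * s j)) :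
    ∃ v, ℓ w = k + ℓ v ∧
      (w = ((altWord i j k).map s).prod * v ∨ w = ((altWord j i k).map s).prod * v) := by
  induction k generalizing i j with
  | zero => exact ⟨w, by simp [altWord]⟩
  | succ k ih =>
    have ho := orderOf_mul_swap h.inv_simple i j
    obtain ⟨v, hl, hv⟩ := ih hi hj (by omega)
    clear ih
    wlog hv' : w = ((altWord i j k).map s).prod * v generalizing i j
    · obtain ⟨v', hv'⟩ := this hj hi (by omega) ho.symm hv.symm (hv.resolve_left hv')
      exact ⟨v', hv'.1, hv'.2.symm⟩
    clear hv
    set u := ((altWord i j k).map s).prod with hu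
    have hju : s j ∉ N u := fun hj => by
      have := h.orderOf_le_of_mem_altWord hj
      omega
    have hjv : u⁻¹ * s j * u ∈ N v := by
      rw [hv'] at hj
      exact (Xor.or ((h.mem_mul u v (s j)).mp hj)).resolve_left hju
    have hlt := h.length_mul_lt hjv
    have hw : w = ((altWord j i (k + 1)).map s).prod * (u⁻¹ * s j * u * v) := by
      simp only [altWord, List.map_cons, List.prod_cons, ← hu]
      rw [hv']
      simp only [mul_assoc, mul_inv_cancel_left, h.simple_mul_cancel]
    refine ⟨_, ?_, Or.inr hw⟩
    have h1 := h.length_mul_le ((altWord j i (k + 1)).map s).prod (u⁻¹ * s j * u * v)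
    have h2 := h.length_le (altWord j i (k + 1))
    rw [length_altWord] at h2
    rw [← hw] at h1
    omega

theorem altWord_prod_eq (i j : ι) :
    ((altWord i j (orderOf (s i * s j))).map s).prod =
      ((altWord j i (orderOf (s i * s j))).map s).prod := by
  rw [altWord_prod_eq_iff s h.simple_mul_self]
  exact pow_orderOf_eq_one _

theorem exists_braid_prefix {w : W} {i j : ι} (hi : s i ∈ N w) (hj : s j ∈ N w) :
    0 < orderOf (s i * s j) ∧ ∃ v, ℓ w = orderOf (s i * s j) + ℓ v ∧
      w = ((altWord i j (orderOf (s i * s j))).map s).prod * v ∧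
      w = ((altWord j i (orderOf (s i * s j))).map s).prod * v := by
  have hpos : 0 < orderOf (s i * s j) := by
    by_contra hc
    -- With infinite order, a prefix longer than `w` itself could be split off.
    obtain ⟨v, hl, -⟩ := h.exists_altWord_prefix hi hj (ℓ w + 1) (by omega)
    omega
  refine ⟨hpos, ?_⟩
  obtain ⟨v, hl, hv⟩ := h.exists_altWord_prefix hi hj _ (Or.inr le_rfl)
  have := h.altWord_prod_eq i j
  refine ⟨v, hl, ?_⟩
  rcases hv with hv | hv
  · exact ⟨hv, this ▸ hv⟩
  · exact ⟨this.symm ▸ hv, hv⟩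

/-- **Matsumoto's theorem**: a family satisfying the braid relations has the same product along any
two reduced expressions of the same element. -/
theorem map_prod_eq_of_reduced {G : Type*} [Monoid G] (f : ι → G)
    (hf : ∀ i j, ((altWord i j (orderOf (s i * s j))).map f).prod =
      ((altWord j i (orderOf (s i * s j))).map f).prod)
    {α β : List ι} (hα : ℓ (α.map s).prod = α.length) (hβ : ℓ (β.map s).prod = β.length)
    (hαβ : (α.map s).prod = (β.map s).prod) : (α.map f).prod = (β.map f).prod := by
  induction hn : α.length using Nat.strong_induction_on generalizing α β with
  | _ n ih =>
    have aux : ∀ (i : ι) (α' γ : List ι), (i :: α').length = n → γ.length + 1 = n →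
        ℓ ((i :: α').map s).prod = n → ((i :: α').map s).prod = ((i :: γ).map s).prod →
        ((i :: α').map f).prod = ((i :: γ).map f).prod := by
      intro i α' γ h1 h2 h3 h4
      simp only [List.map_cons, List.prod_cons, List.length_cons, mul_right_inj] at *
      have h5 := h.length_le α'
      have h6 := h.length_simple_mul_le i (α'.map s).prod
      rw [ih α'.length (by omega) (by omega) (by rw [← h4]; omega) h4 rfl]
    match α, β with
    | [], β =>
      have : β = [] := List.eq_nil_of_length_eq_zero <| by
        rw [← hβ, ← hαβ, List.map_nil, List.prod_nil, h.length_one]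
      rw [this]
    | i :: α', [] =>
      rw [hαβ, List.map_nil, List.prod_nil, h.length_one] at hα
      simp at hα
    | i :: α', j :: β' =>
      have hlen : (j :: β').length = n := by rw [← hβ, ← hαβ, hα, hn]
      have descent : ∀ (i : ι) (α' : List ι),
          ℓ ((i :: α').map s).prod = (i :: α').length → s i ∈ N ((i :: α').map s).prod := by
        intro i α' h1
        rw [h.simple_mem_iff, h1]
        have h2 := h.length_le α'
        simp only [List.map_cons, List.prod_cons, List.length_cons, h.simple_mul_cancel]
        omega
      obtain ⟨hpos, v, hl, hv1, hv2⟩ :=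
        h.exists_braid_prefix (descent i α' hα) (hαβ ▸ descent j β' hβ)
      obtain ⟨γ, rfl, hγ⟩ := h.exists_word v
      obtain ⟨m, hm⟩ : ∃ m, orderOf (s i * s j) = m + 1 := ⟨_, (Nat.sub_add_cancel hpos).symm⟩
      have hfij := hf i j
      rw [hm] at hv1 hv2 hl hfij
      simp only [altWord] at hv1 hv2 hfij
      rw [hα, hn] at hl
      -- Both words are compared with a braid word followed by `γ`; each comparison shares a first
      -- letter, and `hfij` links the two braid words.
      have e1 := aux i α' (altWord j i m ++ γ) hn
        (by rw [List.length_append, length_altWord]; omega) (hα.trans hn)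
        (by rw [hv1]; simp [mul_assoc])
      have e2 := aux j β' (altWord i j m ++ γ) hlen
        (by rw [List.length_append, length_altWord]; omega) (hβ.trans hlen)
        (by rw [← hαβ, hv2]; simp [mul_assoc])
      rw [e1, e2, ← List.cons_append, ← List.cons_append, List.map_append, List.map_append,
        List.prod_append, List.prod_append, hfij]

end IsReflectionCocycle

/-! ### Geometric representation and the order of `s_i s_j` -/

section GeometricRepresentation

open Module Polynomial Polynomial.Chebyshev

variable {ι : Type*} (M : CoxeterMatrix ι)

/-- The linear form `2 B(e_i, ·)` of the geometric representation. -/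
noncomputable def corootForm (i : ι) : Dual ℝ (ι →₀ ℝ) :=
  Finsupp.linearCombination ℝ fun j => -2 * Real.cos (Real.pi / M i j)

/-- For `m = ∞`, encoded as `0`, division by zero gives angle `0` and the correct value `-2`. -/
theorem corootForm_single (i j : ι) :
    corootForm M i (Finsupp.single j 1) = -2 * Real.cos (Real.pi / M i j) := by
  simp [corootForm]

theorem corootForm_self (i : ι) : corootForm M i (Finsupp.single i 1) = 2 := by
  simp [corootForm_single]

/-- The reflection by which the simple generator `s_i` acts in the geometric representation. -/
noncomputable def geomReflection (i : ι) : (ι →₀ ℝ) ≃ₗ[ℝ] (ι →₀ ℝ) :=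
  reflection (corootForm_self M i)

/-- The left side is the trace parameter of the Chebyshev formula for powers of a product of two
reflections; the product rotates by `2π/m`. -/
theorem trace_eq (i j : ι) :
    corootForm M i (Finsupp.single j 1) * corootForm M j (Finsupp.single i 1) - 2 =
      2 * Real.cos (2 * (Real.pi / M i j)) := by
  rw [corootForm_single, corootForm_single, M.symmetric j i, Real.cos_two_mul]
  ring

theorem sin_pi_div_pos {m : ℕ} (hm : 2 ≤ m) : 0 < Real.sin (Real.pi / m) := by
  have : (2 : ℝ) ≤ m := by exact_mod_cast hm
  apply Real.sin_pos_of_pos_of_lt_pi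
  · positivity
  · rw [div_lt_iff₀ (by positivity)]
    nlinarith [Real.pi_pos]

theorem cos_pi_div_pos {m : ℕ} (hm : 3 ≤ m) : 0 < Real.cos (Real.pi / m) := by
  have : (3 : ℝ) ≤ m := by exact_mod_cast hm
  apply Real.cos_pos_of_mem_Ioo
  constructor
  · have : 0 < Real.pi / m := by positivity
    linarith [Real.pi_pos]
  · rw [div_lt_div_iff₀ (by positivity) (by positivity)]
    nlinarith [Real.pi_pos]

theorem geomReflection_mul_pow_of_eq_two {i j : ι} (hm : M i j = 2) :
    (geomReflection M i * geomReflection M j) ^ 2 = 1 := by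
  ext1 z
  have h0 : ∀ i j, M i j = 2 → corootForm M i (Finsupp.single j 1) = 0 := fun i j h => by
    simp [corootForm_single, h]
  have hij := h0 i j hm
  have hji := h0 j i (M.symmetric i j ▸ hm)
  simp only [pow_two, LinearEquiv.mul_apply, geomReflection, reflection_apply, map_sub, map_smul,
    hij, hji, corootForm_self, LinearEquiv.coe_one, id]
  module

theorem geomReflection_mul_pow_of_three_le {i j : ι} (hm : 3 ≤ M i j) :
    (geomReflection M i * geomReflection M j) ^ M i j = 1 := by
  have hs := sin_pi_div_pos (m := M i j) (by omega)
  have hc := cos_pi_div_pos hm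
  set θ := Real.pi / M i j with hθ
  have hmθ : (M i j : ℝ) * θ = Real.pi := by
    rw [hθ]
    field_simp
  have hs2 : Real.sin (2 * θ) ≠ 0 := by
    rw [Real.sin_two_mul]
    positivity
  have hS : ∀ n : ℤ, (S ℝ n).eval (2 * Real.cos (2 * θ)) * Real.sin (2 * θ) =
      Real.sin ((n + 1) * (2 * θ)) := fun n => S_two_mul_real_cos ..
  ext1 z
  have key := reflection_mul_reflection_pow_apply (corootForm_self M i) (corootForm_self M j)
    (M i j) z _ (trace_eq M i j).symm
  rw [← hθ] at key
  rw [geomReflection, geomReflection, key]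
  -- The formula's indices are integer halves, hence the parity split: `sin π = 0` in the even case,
  -- `sin (π + θ) + sin (π - θ) = 0` in the odd one.
  obtain ⟨k, hk | hk⟩ := Nat.even_or_odd' (M i j)
  · have h1 : ((M i j : ℤ) - 2) / 2 = k - 1 := by omega
    have h2 : ((M i j : ℤ) - 1) / 2 = k - 1 := by omega
    have h0 : (S ℝ (k - 1)).eval (2 * Real.cos (2 * θ)) = 0 := by
      have := hS (k - 1)
      rw [show (((k - 1 : ℤ) : ℝ) + 1) * (2 * θ) = Real.pi by
        rw [← hmθ, hk]; push_cast; ring, Real.sin_pi] at this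
      exact (mul_eq_zero.mp this).resolve_right hs2
    simp [h1, h2, h0]
  · have h1 : ((M i j : ℤ) - 2) / 2 = k - 1 := by omega
    have h2 : ((M i j : ℤ) - 1) / 2 = k := by omega
    have h3 : ((M i j : ℤ) - 3) / 2 = k - 1 := by omega
    have h4 : (M i j : ℤ) / 2 = k := by omega
    have h0 : (S ℝ k).eval (2 * Real.cos (2 * θ)) + (S ℝ (k - 1)).eval (2 * Real.cos (2 * θ)) =
        0 := by
      have e1 := hS k
      have e2 := hS (k - 1)
      have e3 : (((k : ℤ) : ℝ) + 1) * (2 * θ) = Real.pi + θ := by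
        rw [← hmθ, hk]; push_cast; ring
      have e4 : (((k - 1 : ℤ) : ℝ) + 1) * (2 * θ) = Real.pi - θ := by
        rw [← hmθ, hk]; push_cast; ring
      rw [e3, Real.sin_add] at e1
      rw [e4, Real.sin_sub] at e2
      simp only [Real.sin_pi, Real.cos_pi] at e1 e2
      refine (mul_eq_zero.mp (?_ : _ * Real.sin (2 * θ) = 0)).resolve_right hs2
      rw [add_mul, e1, e2]
      ring
    simp [h1, h2, h3, h4, h0]

theorem isLiftable_geomReflection : M.IsLiftable (geomReflection M) := by
  intro i j
  rcases eq_or_ne i j with rfl | hij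
  · rw [M.diagonal, pow_one]
    ext1 z
    exact involutive_reflection (corootForm_self M i) z
  · have h1 := M.off_diagonal i j hij
    rcases Nat.lt_or_ge (M i j) 3 with h3 | h3
    · have : M i j = 0 ∨ M i j = 2 := by
        have : M i j ≠ 1 := h1
        omega
      rcases this with h | h
      · rw [h, pow_zero]
      · rw [h, geomReflection_mul_pow_of_eq_two M h]
    · exact geomReflection_mul_pow_of_three_le M h3

/-- Coordinates of the image of `e_i` are compared. For `m ≥ 3` they force `cos (2kθ) = 1`; `m = 0`
and `m = 2` are degenerate, since `sin (2θ) = 0`. -/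
theorem dvd_of_geomReflection_mul_pow {i j : ι} (hij : i ≠ j) {k : ℕ}
    (hk : (geomReflection M i * geomReflection M j) ^ k = 1) : M i j ∣ k := by
  have key := reflection_mul_reflection_pow_apply_self (corootForm_self M i) (corootForm_self M j)
    k _ (trace_eq M i j).symm
  set θ := Real.pi / M i j with hθ
  rw [geomReflection, geomReflection] at hk
  rw [hk] at key
  have ki := DFunLike.congr_fun key i
  have kj := DFunLike.congr_fun key j
  simp [hij, hij.symm, corootForm_single, M.symmetric j i, ← hθ] at ki kj
  have h1 : M i j ≠ 1 := M.off_diagonal i j hij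
  rcases Nat.eq_zero_or_pos (M i j) with h | h
  · rw [hθ, h] at kj
    have hk0 : k = 0 := by simpa using kj
    simp [hk0]
  rcases Nat.lt_or_ge (M i j) 3 with h3 | h3
  · have h2 : M i j = 2 := by omega
    have ht : 2 * Real.cos (2 * θ) = -2 := by
      rw [hθ, h2, show 2 * (Real.pi / (2 : ℕ)) = Real.pi by push_cast; ring, Real.cos_pi]
      norm_num
    rw [ht, S_eval_neg_two, S_eval_neg_two] at ki
    rw [h2, ← even_iff_two_dvd]
    by_contra hodd
    rw [Nat.not_even_iff_odd] at hodd
    have hodd' : Odd (k : ℤ) := by exact_mod_cast hodd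
    rw [Int.negOnePow_odd _ hodd', Int.negOnePow_even _ (hodd'.sub_odd odd_one)] at ki
    push_cast at ki
    linarith
  · have hs := sin_pi_div_pos (m := M i j) (by omega)
    have hc := cos_pi_div_pos h3
    rw [← hθ] at hs hc
    have hs2 : Real.sin (2 * θ) ≠ 0 := by
      rw [Real.sin_two_mul]
      positivity
    have h0 : (S ℝ (k - 1)).eval (2 * Real.cos (2 * θ)) = 0 := kj.resolve_right hc.ne'
    rw [h0, add_zero] at ki
    have e1 := S_two_mul_real_cos (2 * θ) k
    have e2 := S_two_mul_real_cos (2 * θ) (k - 1)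
    rw [← ki, one_mul, add_mul, one_mul, Real.sin_add] at e1
    rw [h0, zero_mul] at e2
    have e3 : Real.sin (k * (2 * θ)) = 0 := by
      rw [e2]
      push_cast
      ring_nf
    push_cast at e1
    rw [e3, zero_mul, zero_add] at e1
    have e4 : Real.cos (k * (2 * θ)) = 1 := by
      apply mul_right_cancel₀ hs2
      rw [one_mul, ← e1]
    obtain ⟨n, hn⟩ := (Real.cos_eq_one_iff _).mp e4
    have e5 : (n : ℝ) * M i j = k := by
      have hM : (M i j : ℝ) ≠ 0 := by exact_mod_cast h.ne'
      have : (n : ℝ) * M i j * (2 * Real.pi) = k * (2 * Real.pi) := by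
        calc _ = (n * (2 * Real.pi)) * M i j := by ring
          _ = _ := by rw [hn, hθ]; field_simp
      exact mul_right_cancel₀ (by positivity) this
    have : (M i j : ℤ) ∣ k := ⟨n, by rw [mul_comm]; exact_mod_cast e5.symm⟩
    exact_mod_cast this

variable {M}
variable {W : Type*} [Group W] (cs : CoxeterSystem M W)

theorem orderOf_simple_mul_simple (i j : ι) : orderOf (cs.simple i * cs.simple j) = M i j := by
  apply Nat.dvd_antisymm
  · exact orderOf_dvd_of_pow_eq_one (cs.simple_mul_simple_pow i j)
  · rcases eq_or_ne i j with rfl | hij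
    · simp
    · apply dvd_of_geomReflection_mul_pow M hij
      have := congrArg (cs.lift ⟨_, isLiftable_geomReflection M⟩)
        (pow_orderOf_eq_one (cs.simple i * cs.simple j))
      rwa [map_pow, map_mul, cs.lift_apply_simple, cs.lift_apply_simple, map_one] at this

end GeometricRepresentation

/-! ### Parity of inversions and the cocycle identity -/

section InversionCocycle

variable {ι W : Type*} [Group W] {M : CoxeterMatrix ι} (cs : CoxeterSystem M W)

open Classical in
/-- The action of a simple generator on `W × ZMod 2`: conjugation on the first factor, with a sign
change at the generator itself. -/
noncomputable def signedConj (i : ι) : Equiv.Perm (W × ZMod 2) :=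
  Function.Involutive.toPerm
    (fun p => (cs.simple i * p.1 * cs.simple i, p.2 + if p.1 = cs.simple i then 1 else 0)) <| by
    rintro ⟨t, ε⟩
    have h : cs.simple i * t * cs.simple i = cs.simple i ↔ t = cs.simple i := by
      rw [mul_eq_right, mul_eq_one_iff_inv_eq, cs.inv_simple, eq_comm]
    have h2 : (1 : ZMod 2) + 1 = 0 := rfl
    refine Prod.ext (by simp [mul_assoc]) ?_
    simp only [h]
    split_ifs <;> simp [add_assoc, h2]

open Classical in
theorem signedConj_prod_apply (ω : List ι) (t : W) (ε : ZMod 2) :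
    (ω.map (signedConj cs)).prod (t, ε) =
      (cs.wordProd ω * t * (cs.wordProd ω)⁻¹, ε + (cs.rightInvSeq ω).count t) := by
  induction ω with
  | nil => simp
  | cons i ω ih =>
    rw [List.map_cons, List.prod_cons, Equiv.Perm.mul_apply, ih]
    have h : cs.wordProd ω * t * (cs.wordProd ω)⁻¹ = cs.simple i ↔
        (cs.wordProd ω)⁻¹ * cs.simple i * cs.wordProd ω = t := by
      rw [mul_inv_eq_iff_eq_mul, mul_assoc, inv_mul_eq_iff_eq_mul, eq_comm]
    change (cs.simple i * (cs.wordProd ω * t * (cs.wordProd ω)⁻¹) * cs.simple i,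
      ε + _ + if cs.wordProd ω * t * (cs.wordProd ω)⁻¹ = cs.simple i then 1 else 0) = _
    rw [cs.wordProd_cons, CoxeterSystem.rightInvSeq, List.count_cons]
    refine Prod.ext (by simp [mul_assoc]) ?_
    simp only [h, beq_iff_eq]
    push_cast
    ring

-- Since `(s_i s_j)^m = 1`, the sequence has period `m` over length `2m`, so its two halves
-- coincide.
open Classical in
theorem even_count_leftInvSeq (i j : ι) (t : W) :
    Even ((cs.leftInvSeq (CoxeterSystem.alternatingWord i j (2 * M i j))).count t) := by
  set L := cs.leftInvSeq (CoxeterSystem.alternatingWord i j (2 * M i j)) with hL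
  have hlen : L.length = 2 * M i j := by simp [hL]
  have hL2 : L.drop (M i j) = L.take (M i j) := by
    apply List.ext_getElem
    · simp [hlen]; omega
    · intro k h1 h2
      simp only [List.length_take, hlen] at h2
      rw [List.getElem_drop, List.getElem_take]
      simp only [hL]
      rw [cs.getElem_leftInvSeq_alternatingWord i j _ _ (by omega),
        cs.getElem_leftInvSeq_alternatingWord i j _ _ (by omega)]
      rw [cs.prod_alternatingWord_eq_mul_pow, cs.prod_alternatingWord_eq_mul_pow]
      have e1 : (2 * (M i j + k) + 1) / 2 = M i j + k := by omega
      have e2 : (2 * k + 1) / 2 = k := by omega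
      rw [e1, e2, pow_add, cs.simple_mul_simple_pow', one_mul]
      simp
  rw [← List.take_append_drop (M i j) L, List.count_append, hL2]
  exact ⟨_, rfl⟩

theorem isLiftable_signedConj : M.IsLiftable (signedConj cs) := by
  classical
  intro i j
  have h : (signedConj cs i * signedConj cs j) ^ M i j =
      ((CoxeterSystem.alternatingWord j i (2 * M i j)).reverse.map (signedConj cs)).prod := by
    generalize M i j = m
    induction m with
    | zero => simp [CoxeterSystem.alternatingWord]
    | succ m ih =>
      rw [pow_succ', ih, show 2 * (m + 1) = 2 * m + 1 + 1 by ring,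
        CoxeterSystem.alternatingWord_succ, CoxeterSystem.alternatingWord_succ]
      simp [mul_assoc]
  rw [h]
  ext1 ⟨t, ε⟩
  have h2 : cs.wordProd (CoxeterSystem.alternatingWord j i (2 * M i j)) = 1 := by
    rw [cs.prod_alternatingWord_eq_mul_pow]
    simp
  have h3 := even_count_leftInvSeq cs j i t
  rw [M.symmetric j i] at h3
  have h4 : ((List.count t (cs.leftInvSeq (CoxeterSystem.alternatingWord j i (2 * M i j))) : ℕ) :
      ZMod 2) = 0 := (ZMod.natCast_eq_zero_iff_even).mpr h3
  rw [signedConj_prod_apply, cs.wordProd_reverse, cs.rightInvSeq_reverse, List.count_reverse, h2,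
    h4]
  simp

/-- The parity of the number of occurrences of `t` in the left inversion sequence of any expression
of `w`. -/
noncomputable def inversionParity (w t : W) : ZMod 2 :=
  (cs.lift ⟨_, isLiftable_signedConj cs⟩ w⁻¹ (t, 0)).2

theorem lift_signedConj_wordProd (ω : List ι) :
    cs.lift ⟨_, isLiftable_signedConj cs⟩ (cs.wordProd ω) = (ω.map (signedConj cs)).prod := by
  rw [CoxeterSystem.wordProd, map_list_prod, List.map_map]
  congr 1
  exact List.map_congr_left fun i _ => cs.lift_apply_simple _ i

open Classical in
theorem lift_signedConj_apply (w t : W) (ε : ZMod 2) :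
    cs.lift ⟨_, isLiftable_signedConj cs⟩ w⁻¹ (t, ε) =
      (w⁻¹ * t * w, ε + inversionParity cs w t) := by
  rw [inversionParity]
  obtain ⟨ω, hω⟩ := cs.wordProd_surjective w⁻¹
  have hω' : w = (cs.wordProd ω)⁻¹ := by rw [hω, inv_inv]
  rw [← hω, lift_signedConj_wordProd, signedConj_prod_apply, signedConj_prod_apply, hω']
  simp

open Classical in
theorem inversionParity_wordProd (ω : List ι) (t : W) :
    inversionParity cs (cs.wordProd ω) t = (cs.leftInvSeq ω).count t := by
  rw [inversionParity, ← cs.wordProd_reverse, lift_signedConj_wordProd, signedConj_prod_apply,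
    cs.rightInvSeq_reverse, List.count_reverse, zero_add]

/-- The cocycle identity is the homomorphism property of the action, read in the sign coordinate. -/
theorem inversionParity_mul (x y t : W) :
    inversionParity cs (x * y) t = inversionParity cs x t + inversionParity cs y (x⁻¹ * t * x) := by
  have h := lift_signedConj_apply cs (x * y) t 0
  rw [mul_inv_rev, map_mul, Equiv.Perm.mul_apply, lift_signedConj_apply, lift_signedConj_apply] at h
  simpa using (congrArg Prod.snd h).symm

theorem inversionParity_one (t : W) : inversionParity cs 1 t = 0 := by
  simp [inversionParity]

open Classical in
theorem inversionParity_simple (i : ι) (t : W) :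
    inversionParity cs (cs.simple i) t = if t = cs.simple i then 1 else 0 := by
  have h := inversionParity_wordProd cs [i] t
  rw [cs.wordProd_singleton] at h
  rw [h, cs.leftInvSeq_singleton, List.count_singleton]
  simp only [beq_iff_eq, @eq_comm _ _ t]
  split_ifs <;> simp

theorem inversionParity_self {t : W} (ht : cs.IsReflection t) : inversionParity cs t t = 1 := by
  obtain ⟨u, i, rfl⟩ := ht
  have h := inversionParity_mul cs u u⁻¹ (u * cs.simple i * u⁻¹)
  rw [mul_inv_cancel, inversionParity_one] at h
  rw [inversionParity_mul, inversionParity_mul]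
  simp only [mul_assoc, inv_mul_cancel_left, inv_mul_cancel, mul_one, cs.inv_simple, mul_inv_rev,
    cs.simple_mul_simple_self, inversionParity_simple, if_true] at h ⊢
  rw [add_right_comm, ← h, zero_add]

theorem mem_inversionSet_of_parity {w t : W} (h : inversionParity cs w t ≠ 0) :
    t ∈ inversionSet cs w := by
  classical
  obtain ⟨ω, hω, rfl⟩ := cs.exists_isReduced w
  rw [inversionParity_wordProd] at h
  have : t ∈ cs.leftInvSeq ω := by
    by_contra hc
    simp [List.count_eq_zero_of_not_mem hc] at h
  exact cs.isLeftInversion_of_mem_leftInvSeq hω this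

theorem mem_inversionSet_iff (w t : W) : t ∈ inversionSet cs w ↔ inversionParity cs w t = 1 := by
  constructor
  · rintro ⟨ht, hl⟩
    by_contra hc
    -- Multiplying by `t` flips the parity, so `t` would also shorten `t * w`.
    have h1 : inversionParity cs (t * w) t ≠ 0 := by
      rw [inversionParity_mul, inversionParity_self cs ht, inv_mul_cancel, one_mul]
      revert hc
      generalize inversionParity cs w t = a
      revert a
      decide
    have h2 := (mem_inversionSet_of_parity cs h1).2
    rw [← mul_assoc, ht.mul_self, one_mul] at h2
    omega
  · intro h
    exact mem_inversionSet_of_parity cs (by rw [h]; decide)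

theorem isReflectionCocycle_inversionSet :
    IsReflectionCocycle cs.simple (inversionSet cs) cs.length where
  simple_mul_self := cs.simple_mul_simple_self
  simple i := by
    ext t
    rw [mem_inversionSet_iff, inversionParity_simple, Set.mem_singleton_iff]
    split_ifs <;> simp [*]
  mem_mul x y t := by
    simp only [mem_inversionSet_iff, inversionParity_mul]
    generalize inversionParity cs x t = a
    generalize inversionParity cs y _ = b
    revert a b
    unfold Xor
    decide
  length_le ω := cs.length_wordProd_le ω
  exists_word w := by
    obtain ⟨ω, hω, rfl⟩ := cs.exists_isReduced w
    exact ⟨ω, rfl, hω.symm⟩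

/-- The positive lift does not depend on the reduced expression. -/
theorem eq_posLift {w : W} {β : ArtinGroup M} (hβ : IsPositiveLift cs w β) : β = posLift cs w := by
  obtain ⟨ω, hω, rfl, rfl⟩ := hβ
  obtain ⟨ω', hω', hw, hβ⟩ := (exists_isPositiveLift cs (cs.wordProd ω)).choose_spec
  rw [posLift, ← hβ]
  refine (isReflectionCocycle_inversionSet cs).map_prod_eq_of_reduced (artinGen M) (fun i j => ?_)
    hω hω' hw.symm
  rw [orderOf_simple_mul_simple, ← alternatingWord_prod_eq_iff]
  have h : PresentedGroup.mk (Set.range (Function.uncurry (braidRelation M)))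
      (braidRelation M i j) = 1 :=
    (QuotientGroup.eq_one_iff _).mpr (Subgroup.subset_normalClosure ⟨(i, j), rfl⟩)
  rw [braidRelation, map_mul, map_inv, mul_inv_eq_one, map_list_prod, map_list_prod, List.map_map,
    List.map_map] at h
  exact h

end InversionCocycle

/-! ### Coxeter systems from cocycles -/

section CoxeterSystemOfCocycle

variable {ι W : Type*} [Group W] {s : ι → W} {N : W → Set W} {ℓ : W → ℕ}

/-- A group with a reflection cocycle is a Coxeter group. -/
theorem IsReflectionCocycle.exists_coxeterSystem (h : IsReflectionCocycle s N ℓ)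
    (M : CoxeterMatrix ι) (hM : ∀ i j, M i j = orderOf (s i * s j)) :
    ∃ cs : CoxeterSystem M W, cs.simple = s := by
  have hlift : M.IsLiftable s := fun i j => by rw [hM, pow_orderOf_eq_one]
  let cs' := M.toCoxeterSystem
  let φ := cs'.lift ⟨s, hlift⟩
  have hφ : ∀ i, φ (cs'.simple i) = s i := cs'.lift_apply_simple hlift
  have hφw : ∀ ω, φ (cs'.wordProd ω) = (ω.map s).prod := fun ω => by
    rw [CoxeterSystem.wordProd, map_list_prod, List.map_map]
    congr 1
    exact List.map_congr_left fun i _ => hφ i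
  have hred : ∀ ω ω' : List ι, ℓ (ω.map s).prod = ω.length → ℓ (ω'.map s).prod = ω'.length →
      (ω.map s).prod = (ω'.map s).prod → cs'.wordProd ω = cs'.wordProd ω' := by
    refine fun ω ω' h1 h2 h3 => h.map_prod_eq_of_reduced cs'.simple (fun i j => ?_) h1 h2 h3
    rw [altWord_prod_eq_iff _ cs'.simple_mul_simple_self, ← hM, cs'.simple_mul_simple_pow]
  -- Every element of the presented group has a word that is reduced in `W`; with `hred` this makes
  -- `φ` injective.
  have hex : ∀ x, ∃ ω, cs'.wordProd ω = x ∧ ℓ (ω.map s).prod = ω.length := by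
    intro x
    induction x using cs'.simple_induction_left with
    | one => exact ⟨[], cs'.wordProd_nil, by simp [h.length_one]⟩
    | mul_simple_left x i ih =>
      obtain ⟨ω, rfl, hω⟩ := ih
      by_cases hi : s i ∈ N (ω.map s).prod
      · obtain ⟨α, hα, hl⟩ := h.exists_word (s i * (ω.map s).prod)
        have h1 := h.length_simple_mul_of_mem hi
        have h2 : ((i :: α).map s).prod = (ω.map s).prod := by
          simp [hα, h.simple_mul_cancel]
        have h3 := hred (i :: α) ω (by rw [h2, List.length_cons, hl, h1]) hω h2
        refine ⟨α, ?_, by rw [hα, hl]⟩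
        rw [← h3, cs'.wordProd_cons, cs'.simple_mul_simple_cancel_left]
      · refine ⟨i :: ω, cs'.wordProd_cons i ω, ?_⟩
        rw [List.map_cons, List.prod_cons, h.length_simple_mul_of_notMem hi, hω, List.length_cons]
  have hbij : Function.Bijective φ := by
    constructor
    · intro x y hxy
      obtain ⟨ω, rfl, hω⟩ := hex x
      obtain ⟨ω', rfl, hω'⟩ := hex y
      rw [hφw, hφw] at hxy
      exact hred _ _ hω hω' hxy
    · intro w
      obtain ⟨ω, rfl, -⟩ := h.exists_word w
      exact ⟨_, hφw ω⟩
  refine ⟨cs'.map (MulEquiv.ofBijective φ hbij), funext fun i => ?_⟩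
  rw [cs'.map_simple]
  exact hφ i

theorem isReflectionCocycle_of_closure (s : ι → W) (N : W → Set W)
    (mul_self : ∀ i, s i * s i = 1) (simple : ∀ i, N (s i) = {s i})
    (mem_mul : ∀ x y t, t ∈ N (x * y) ↔ Xor (t ∈ N x) (x⁻¹ * t * x ∈ N y))
    (hgen : Subgroup.closure (Set.range s) = ⊤) : ∃ ℓ, IsReflectionCocycle s N ℓ := by
  classical
  have hex : ∀ w : W, ∃ n, ∃ ω : List ι, (ω.map s).prod = w ∧ ω.length = n := by
    intro w
    have hw : w ∈ Subgroup.closure (Set.range s) := hgen ▸ Subgroup.mem_top w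
    induction hw using Subgroup.closure_induction with
    | mem x hx =>
      obtain ⟨i, rfl⟩ := hx
      exact ⟨1, [i], by simp⟩
    | one => exact ⟨0, [], by simp⟩
    | mul x y _ _ hx hy =>
      obtain ⟨_, ω, rfl, -⟩ := hx
      obtain ⟨_, ω', rfl, -⟩ := hy
      exact ⟨_, ω ++ ω', by simp, rfl⟩
    | inv x _ hx =>
      obtain ⟨_, ω, rfl, -⟩ := hx
      refine ⟨_, ω.reverse, ?_, rfl⟩
      rw [List.prod_inv_reverse, List.map_map, List.map_reverse]
      congr 2
      exact List.map_congr_left fun i _ => (inv_eq_of_mul_eq_one_right (mul_self i)).symm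
  exact ⟨fun w => Nat.find (hex w), mul_self, simple, mem_mul,
    fun ω => Nat.find_min' (hex _) ⟨ω, rfl, rfl⟩, fun w => Nat.find_spec (hex w)⟩

theorem IsReflectionCocycle.exists_decomposition (h : IsReflectionCocycle s N ℓ) {w t : W}
    (ht : t ∈ N w) : ∃ x i y, w = x * s i * y ∧ t = x * s i * x⁻¹ ∧ ℓ w = ℓ x + 1 + ℓ y := by
  induction w using h.reduced_induction generalizing t with
  | one => exact absurd ht (h.notMem_one t)
  | mul i v hi ih =>
    rw [h.length_simple_mul_of_notMem hi]
    rcases Xor.or ((h.mem_simple_mul i v t).mp ht) with rfl | ht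
    · exact ⟨1, i, v, by simp, by simp, by rw [h.length_one]; ring⟩
    · obtain ⟨x, j, y, rfl, e, hl⟩ := ih ht
      refine ⟨s i * x, j, y, by simp only [mul_assoc], ?_, ?_⟩
      · calc t = s i * (s i * t * s i) * (s i)⁻¹ := by
              rw [h.inv_simple]
              simp only [mul_assoc, h.simple_mul_self, mul_one, h.simple_mul_cancel]
          _ = _ := by rw [e]; group
      · have h1 := h.length_simple_mul_le i x
        have h2 := h.length_mul_le (s i * x * s j) y
        have h3 := h.length_mul_le (s i * x) (s j)
        have h4 := h.length_simple_le j
        have h5 := h.length_simple_mul_of_notMem hi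
        rw [show s i * x * s j * y = s i * (x * s j * y) by simp only [mul_assoc]] at h2
        omega

end CoxeterSystemOfCocycle

/-! ### Canonical generators of a reflection subgroup -/

section ReflectionSubgroupCocycle

variable {ι W : Type*} [Group W] {M : CoxeterMatrix ι} (cs : CoxeterSystem M W) (W₀ : Subgroup W)

theorem self_mem_inversionSet {t : W} (ht : cs.IsReflection t) : t ∈ inversionSet cs t :=
  (mem_inversionSet_iff cs t t).mpr (inversionParity_self cs ht)

/-- Write `t = x s x⁻¹` with `ℓ(t) = 2ℓ(x) + 1`. If `t ∉ S₀`, some reflection `r ∈ W₀` shortens `x`;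
then `r` and `r t r⁻¹` are shorter than `t`, and together they generate it. -/
theorem reflection_mem_closure_canonicalGens {t : W} (ht : cs.IsReflection t) (htW : t ∈ W₀) :
    t ∈ Subgroup.closure (canonicalGens cs W₀) := by
  have h := isReflectionCocycle_inversionSet cs
  induction hn : cs.length t using Nat.strong_induction_on generalizing t with
  | _ n ih =>
    by_cases hS : t ∈ canonicalGens cs W₀
    · exact Subgroup.subset_closure hS
    have htN := self_mem_inversionSet cs ht
    obtain ⟨x, i, y, e1, e2, hl⟩ := h.exists_decomposition htN
    obtain rfl : y = x⁻¹ := mul_left_cancel (e1.symm.trans e2)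
    rw [cs.length_inv] at hl
    obtain ⟨t', ht', htW', hne⟩ : ∃ t' ∈ inversionSet cs t, t' ∈ W₀ ∧ t' ≠ t := by
      by_contra! hc
      exact hS ⟨ht, Set.Subset.antisymm (fun u hu => hc u hu.1 hu.2)
        (Set.singleton_subset_iff.mpr ⟨htN, htW⟩)⟩
    -- The inversion `t'` arises from `x`, from `s` (forcing `t' = t`), or from `x⁻¹`, where
    -- conjugation by `t` moves it to `N(x)`.
    obtain ⟨r, hr, hrW⟩ : ∃ r ∈ inversionSet cs x, r ∈ W₀ := by
      rw [e2] at ht'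
      rcases Xor.or ((h.mem_mul _ _ _).mp ht') with hu | hu
      · rcases Xor.or ((h.mem_mul _ _ _).mp hu) with hu | hu
        · exact ⟨t', hu, htW'⟩
        · rw [h.simple, Set.mem_singleton_iff] at hu
          exact absurd (by rw [e2, ← hu]; group) hne
      · rw [h.mem_inv] at hu
        refine ⟨t * t' * t, ?_, W₀.mul_mem (W₀.mul_mem htW htW') htW⟩
        convert hu using 1
        nth_rw 1 [← ht.inv]
        rw [e2]
        group
    have hlr := hr.2
    have h1 : r ∈ Subgroup.closure (canonicalGens cs W₀) := by
      refine ih _ ?_ hr.1 hrW rfl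
      have := cs.length_mul_le (r * x) x⁻¹
      rw [mul_inv_cancel_right, cs.length_inv] at this
      omega
    have h2 : r * t * r⁻¹ ∈ Subgroup.closure (canonicalGens cs W₀) := by
      refine ih _ ?_ (ht.conj r) (W₀.mul_mem (W₀.mul_mem hrW htW) (W₀.inv_mem hrW)) rfl
      have e3 : r * t * r⁻¹ = r * x * cs.simple i * (r * x)⁻¹ := by rw [e2]; group
      have h3 := cs.length_mul_le (r * x * cs.simple i) (r * x)⁻¹
      have h4 := cs.length_mul_le (r * x) (cs.simple i)
      rw [cs.length_inv] at h3
      rw [cs.length_simple] at h4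
      rw [e3]
      omega
    have h3 := mul_mem (mul_mem (inv_mem h1) h2) h1
    rwa [show r⁻¹ * (r * t * r⁻¹) * r = t by group] at h3

theorem canonicalGens_subset (t : canonicalGens cs W₀) : (t : W) ∈ W₀ :=
  (t.2.2.symm.subset rfl).2

/-- The canonical generators as elements of the reflection subgroup. -/
def canonicalGen (t : canonicalGens cs W₀) : W₀ := ⟨t, canonicalGens_subset cs W₀ t⟩

/-- The left inversion set relative to the reflection subgroup `W₀`. -/
def relInversionSet (w : W₀) : Set W₀ := {t | (t : W) ∈ inversionSet cs w}

theorem closure_range_canonicalGen (hW₀ : IsReflectionSubgroup cs W₀) :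
    Subgroup.closure (Set.range (canonicalGen cs W₀)) = ⊤ := by
  apply Subgroup.map_injective W₀.subtype_injective
  rw [MonoidHom.map_closure, ← MonoidHom.range_eq_map, W₀.range_subtype, ← Set.range_comp]
  have : Set.range (W₀.subtype ∘ canonicalGen cs W₀) = canonicalGens cs W₀ := Subtype.range_coe
  rw [this]
  apply le_antisymm
  · rw [Subgroup.closure_le]
    exact fun t ht => canonicalGens_subset cs W₀ ⟨t, ht⟩
  · obtain ⟨A, hA, rfl⟩ := hW₀
    rw [Subgroup.closure_le]
    exact fun t ht => reflection_mem_closure_canonicalGens cs _ (hA t ht) (Subgroup.subset_closure ht)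

theorem canonicalGen_mul_self (t : canonicalGens cs W₀) :
    canonicalGen cs W₀ t * canonicalGen cs W₀ t = 1 :=
  Subtype.ext t.2.1.mul_self

theorem relInversionSet_canonicalGen (t : canonicalGens cs W₀) :
    relInversionSet cs W₀ (canonicalGen cs W₀ t) = {canonicalGen cs W₀ t} := by
  ext u
  have := Set.ext_iff.mp t.2.2 u
  simp only [Set.mem_inter_iff, SetLike.mem_coe, u.2, and_true, Set.mem_singleton_iff] at this
  rw [Set.mem_singleton_iff, Subtype.ext_iff]
  exact this

theorem mem_relInversionSet_mul (x y t : W₀) : t ∈ relInversionSet cs W₀ (x * y) ↔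
    Xor (t ∈ relInversionSet cs W₀ x) (x⁻¹ * t * x ∈ relInversionSet cs W₀ y) :=
  (isReflectionCocycle_inversionSet cs).mem_mul x y t

/-- A reflection subgroup is a Coxeter group with respect to its canonical generators. -/
theorem exists_coxeterSystem_canonicalMatrix (hW₀ : IsReflectionSubgroup cs W₀) :
    ∃ cs₀ : CoxeterSystem (canonicalMatrix cs W₀) W₀, cs₀.simple = canonicalGen cs W₀ := by
  obtain ⟨ℓ, h⟩ := isReflectionCocycle_of_closure _ _ (canonicalGen_mul_self cs W₀)
    (relInversionSet_canonicalGen cs W₀) (mem_relInversionSet_mul cs W₀)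
    (closure_range_canonicalGen cs W₀ hW₀)
  exact h.exists_coxeterSystem _ fun i j =>
    Subgroup.orderOf_coe (canonicalGen cs W₀ i * canonicalGen cs W₀ j)

theorem isReflectionCocycle_relInversionSet (cs₀ : CoxeterSystem (canonicalMatrix cs W₀) W₀)
    (hcs₀ : cs₀.simple = canonicalGen cs W₀) :
    IsReflectionCocycle cs₀.simple (relInversionSet cs W₀) cs₀.length where
  simple_mul_self := cs₀.simple_mul_simple_self
  simple i := by rw [hcs₀, relInversionSet_canonicalGen]
  mem_mul := mem_relInversionSet_mul cs W₀
  length_le ω := cs₀.length_wordProd_le ω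
  exists_word w := by
    obtain ⟨ω, hω, rfl⟩ := cs₀.exists_isReduced w
    exact ⟨ω, rfl, hω.symm⟩

end ReflectionSubgroupCocycle

/-! ### Multiplicativity of `ψ` and the induced homomorphism -/

section Psi

variable {ι W : Type*} [Group W] {M : CoxeterMatrix ι} (cs : CoxeterSystem M W) (W₀ : Subgroup W)

theorem posLift_one : posLift cs 1 = 1 :=
  (eq_posLift cs ⟨[], by simp [CoxeterSystem.IsReduced], by simp, rfl⟩).symm

theorem posLift_simple_mul {i : ι} {w : W} (hi : cs.simple i ∉ inversionSet cs w) :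
    posLift cs (cs.simple i * w) = artinGen M i * posLift cs w := by
  obtain ⟨ω, hω, rfl, hβ⟩ := (exists_isPositiveLift cs w).choose_spec
  rw [posLift.eq_def cs (cs.wordProd ω), ← hβ]
  refine (eq_posLift cs ⟨i :: ω, ?_, cs.wordProd_cons i ω, by simp [artinWord]⟩).symm
  rw [CoxeterSystem.IsReduced, cs.wordProd_cons,
    (isReflectionCocycle_inversionSet cs).length_simple_mul_of_notMem hi, hω, List.length_cons]

theorem posLift_mul_simple {i : ι} {w : W} (hi : cs.length (w * cs.simple i) = cs.length w + 1) :
    posLift cs (w * cs.simple i) = posLift cs w * artinGen M i := by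
  obtain ⟨ω, hω, rfl, hβ⟩ := (exists_isPositiveLift cs w).choose_spec
  rw [posLift.eq_def cs (cs.wordProd ω), ← hβ]
  refine (eq_posLift cs ⟨ω ++ [i], ?_, by simp [cs.wordProd_append], by simp [artinWord]⟩).symm
  rw [CoxeterSystem.IsReduced, cs.wordProd_append, cs.wordProd_singleton, hi, hω]
  simp

/-- Modulo `K₀`, multiplying a positive lift by a generator gives a positive lift, unless the
corresponding reflection lies in `W₀` and the length decreases. -/
theorem posLift_mul_artinGen_mem {i : ι} {x : W}
    (hi : cs.simple i ∈ inversionSet cs x⁻¹ → x * cs.simple i * x⁻¹ ∉ W₀) :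
    posLift cs x * artinGen M i * (posLift cs (x * cs.simple i))⁻¹ ∈ K₀ cs W₀ := by
  rcases cs.length_mul_simple x i with hl | hl
  · rw [posLift_mul_simple cs hl, mul_inv_cancel]
    exact one_mem _
  · have h1 := posLift_mul_simple cs (w := x * cs.simple i) (i := i) (by simp [hl])
    rw [cs.simple_mul_simple_cancel_right] at h1
    have hx : cs.simple i ∈ inversionSet cs x⁻¹ := by
      refine ⟨cs.isReflection_simple i, ?_⟩
      have h2 : cs.simple i * x⁻¹ = (x * cs.simple i)⁻¹ := by simp
      rw [h2, cs.length_inv, cs.length_inv]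
      omega
    refine Subgroup.subset_closure ⟨posLift cs (x * cs.simple i), i, ?_, ?_⟩
    · simpa [artinProj_posLift, mul_assoc] using hi hx
    · rw [h1, pow_two]
      simp only [mul_assoc]

/-- Positive lifts multiply modulo `K₀` if no inversion in `W₀` cancels. -/
theorem posLift_mul_mem (x y : W)
    (hxy : ∀ t ∈ inversionSet cs x⁻¹, t ∈ inversionSet cs y → x * t * x⁻¹ ∉ W₀) :
    posLift cs x * posLift cs y * (posLift cs (x * y))⁻¹ ∈ K₀ cs W₀ := by
  have h := isReflectionCocycle_inversionSet cs
  induction y using h.reduced_induction generalizing x with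
  | one => simp [posLift_one]
  | mul i v hi ih =>
    have h1 : cs.simple i ∈ inversionSet cs (cs.simple i * v) :=
      (h.simple_mem_simple_mul i v).mpr hi
    have h2 := posLift_mul_artinGen_mem cs W₀ (i := i) (x := x) fun hx => hxy _ hx h1
    -- The first letter of `y` moves over to `x`; common inversions of the new pair are conjugates
    -- by `s_i` of common inversions of the old one.
    have h3 := ih (x * cs.simple i) fun t ht htv => by
      have hti : t ≠ cs.simple i := fun e => hi (e ▸ htv)
      rw [mul_inv_rev, cs.inv_simple, h.mem_simple_mul] at ht
      have ht' := (Xor.or ht).resolve_left hti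
      have := hxy _ ht' <| by
        rw [h.mem_simple_mul]
        refine Or.inr ⟨?_, fun e => hti ?_⟩
        · simpa [mul_assoc] using htv
        · rw [mul_assoc, mul_eq_left, mul_eq_one_iff_eq_inv, cs.inv_simple] at e
          exact e
      simpa [mul_assoc] using this
    rw [posLift_simple_mul cs hi]
    have h4 := mul_mem h2 h3
    convert h4 using 1
    simp only [mul_assoc, inv_mul_cancel_left]

theorem psi_mul {x y : W₀}
    (hxy : ∀ t ∈ relInversionSet cs W₀ x⁻¹, t ∉ relInversionSet cs W₀ y) :
    psi cs W₀ (x * y) = psi cs W₀ x * psi cs W₀ y := by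
  have h := posLift_mul_mem cs W₀ x y fun t ht ht' hW => by
    have htW : t ∈ W₀ := by
      have := W₀.mul_mem (W₀.mul_mem (W₀.inv_mem x.2) hW) x.2
      rwa [show (x : W)⁻¹ * (x * t * (x : W)⁻¹) * x = t by group] at this
    exact hxy ⟨t, htW⟩ ht ht'
  unfold psi
  rw [← QuotientGroup.mk_mul, eq_comm, ← mul_inv_eq_one, ← QuotientGroup.mk_inv,
    ← QuotientGroup.mk_mul, QuotientGroup.eq_one_iff]
  exact h

theorem psi_one : psi cs W₀ 1 = 1 := by
  have := psi_mul cs W₀ (x := 1) (y := 1) fun t ht ht' =>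
    (isReflectionCocycle_inversionSet cs).notMem_one _ ht'
  simpa using this

/-- `K₀` lies in the kernel of `π`, so `π` recovers `w` from the class of its lift. -/
theorem psi_injective : Function.Injective (psi cs W₀) := by
  intro x y hxy
  rw [psi, psi, QuotientGroup.eq] at hxy
  have h := MonoidHom.mem_ker.mp (K₀_le_ker cs W₀ hxy)
  have h' : (artinProj cs (posLift cs x))⁻¹ * artinProj cs (posLift cs y) = 1 := by
    rw [← map_inv, ← map_mul]
    exact h
  rw [artinProj_posLift, artinProj_posLift, inv_mul_eq_one] at h'
  exact Subtype.ext h'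

variable {cs W₀} {cs₀ : CoxeterSystem (canonicalMatrix cs W₀) W₀}

theorem psi_mul_of_length (hcs₀ : cs₀.simple = canonicalGen cs W₀) {x y : W₀}
    (hl : cs₀.length (x * y) = cs₀.length x + cs₀.length y) :
    psi cs W₀ (x * y) = psi cs W₀ x * psi cs W₀ y := by
  have h := isReflectionCocycle_relInversionSet cs W₀ cs₀ hcs₀
  refine psi_mul cs W₀ fun t ht ht' => ?_
  rw [h.mem_inv] at ht
  refine h.notMem_of_length_mul hl ht ?_
  simpa [mul_assoc] using ht'

theorem psi_wordProd (hcs₀ : cs₀.simple = canonicalGen cs W₀) {ω : List (canonicalGens cs W₀)}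
    (hω : cs₀.IsReduced ω) :
    psi cs W₀ (cs₀.wordProd ω) = (ω.map fun t => psi cs W₀ (cs₀.simple t)).prod := by
  induction ω with
  | nil => simp [psi_one]
  | cons t ω ih =>
    have hω' : cs₀.IsReduced ω := hω.drop 1
    rw [cs₀.wordProd_cons, psi_mul_of_length hcs₀, ih hω', List.map_cons, List.prod_cons]
    rw [← cs₀.wordProd_cons, hω.eq, hω'.eq, cs₀.length_simple, List.length_cons, add_comm]

theorem psi_alternatingWord (hcs₀ : cs₀.simple = canonicalGen cs W₀) (i j : canonicalGens cs W₀) :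
    ((altWord i j (canonicalMatrix cs W₀ i j)).map fun t => psi cs W₀ (cs₀.simple t)).prod =
      ((altWord j i (canonicalMatrix cs W₀ i j)).map fun t => psi cs W₀ (cs₀.simple t)).prod := by
  have h := isReflectionCocycle_relInversionSet cs W₀ cs₀ hcs₀
  rw [← orderOf_simple_mul_simple cs₀ i j]
  have hred : ∀ i j, cs₀.IsReduced (altWord i j (orderOf (cs₀.simple i * cs₀.simple j))) :=
    fun i j => (h.length_altWord_prod (Or.inr le_rfl)).trans (length_altWord ..).symm
  rw [← psi_wordProd hcs₀ (hred i j)]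
  have hji := hred j i
  rw [← IsReflectionCocycle.orderOf_mul_swap cs₀.inv_simple i j] at hji
  rw [← psi_wordProd hcs₀ hji]
  exact congrArg _ (h.altWord_prod_eq i j)

/-- Uniqueness holds because each Artin generator is itself the positive lift of a one-letter word.
-/
theorem existsUnique_artinHom (hcs₀ : cs₀.simple = canonicalGen cs W₀) :
    ∃! f : ArtinGroup (canonicalMatrix cs W₀) →* LiftQuotient cs W₀,
      ∀ (w : W₀) (β : ArtinGroup (canonicalMatrix cs W₀)),
        IsPositiveLift cs₀ w β → f β = psi cs W₀ w := by
  have hrel : ∀ r ∈ Set.range (Function.uncurry (braidRelation (canonicalMatrix cs W₀))),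
      FreeGroup.lift (fun t => psi cs W₀ (cs₀.simple t)) r = 1 := by
    rintro _ ⟨⟨i, j⟩, rfl⟩
    have h := (alternatingWord_prod_eq_iff _ i j _).mpr (psi_alternatingWord hcs₀ i j)
    simp only [Function.uncurry, braidRelation, map_mul, map_inv, map_list_prod, List.map_map,
      Function.comp_def, FreeGroup.lift_apply_of, mul_inv_eq_one]
    exact h
  refine ⟨PresentedGroup.toGroup hrel, ?_, fun f hf => ?_⟩
  · rintro w β ⟨ω, hω, rfl, rfl⟩
    rw [psi_wordProd hcs₀ hω, artinWord, map_list_prod, List.map_map]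
    congr 1
    exact List.map_congr_left fun t _ => PresentedGroup.toGroup.of hrel
  · refine PresentedGroup.ext fun t => ?_
    rw [PresentedGroup.toGroup.of]
    exact hf _ _ ⟨[t], by simp [CoxeterSystem.IsReduced], by simp, by simp [artinWord, artinGen]⟩

end Psi

end ArtinLift

theorem corollary3p7 {ι W : Type*} [Group W] {M : CoxeterMatrix ι} (cs : CoxeterSystem M W)
    (W₀ : Subgroup W) (hW₀ : ArtinLift.IsReflectionSubgroup cs W₀) :
    -- the positive lift is independent of the reduced expression, and `ψ` is injective
    (∀ (w : W) (β : ArtinLift.ArtinGroup M),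
      ArtinLift.IsPositiveLift cs w β → β = ArtinLift.posLift cs w) ∧
    Function.Injective (ArtinLift.psi cs W₀) ∧
    -- `(W₀, S₀)` is a Coxeter system
    ∃ cs₀ : CoxeterSystem (ArtinLift.canonicalMatrix cs W₀) W₀,
      (∀ t : ArtinLift.canonicalGens cs W₀, ((cs₀.simple t : W₀) : W) = (t : W)) ∧
      -- `ψ` is multiplicative on length-additive pairs
      (∀ w₁ w₂ : W₀, cs₀.length (w₁ * w₂) = cs₀.length w₁ + cs₀.length w₂ →
        ArtinLift.psi cs W₀ (w₁ * w₂) = ArtinLift.psi cs W₀ w₁ * ArtinLift.psi cs W₀ w₂) ∧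
      -- `ψ` is multiplicative on reduced expressions
      (∀ ω : List (ArtinLift.canonicalGens cs W₀), cs₀.IsReduced ω →
        ArtinLift.psi cs W₀ (cs₀.wordProd ω) =
          (ω.map fun t => ArtinLift.psi cs W₀ (cs₀.simple t)).prod) ∧
      -- `ψ` induces a unique homomorphism from the Artin group of `(W₀, S₀)`
      ∃! f : ArtinLift.ArtinGroup (ArtinLift.canonicalMatrix cs W₀) →*
          ArtinLift.LiftQuotient cs W₀,
        ∀ (w : W₀) (β : ArtinLift.ArtinGroup (ArtinLift.canonicalMatrix cs W₀)),
          ArtinLift.IsPositiveLift cs₀ w β → f β = ArtinLift.psi cs W₀ w := by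
  obtain ⟨cs₀, hcs₀⟩ := ArtinLift.exists_coxeterSystem_canonicalMatrix cs W₀ hW₀
  refine ⟨fun w β hβ => ArtinLift.eq_posLift cs hβ, ArtinLift.psi_injective cs W₀, cs₀,
    fun t => by rw [hcs₀]; rfl, fun w₁ w₂ hl => ArtinLift.psi_mul_of_length hcs₀ hl,
    fun ω hω => ArtinLift.psi_wordProd hcs₀ hω, ArtinLift.existsUnique_artinHom hcs₀⟩
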